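/- Let $\mathbb F_q$ be a finite field with $q$ elements, $K=\mathbb F_q((x))$ the field of formal Laurent series with the absolute value normalized by $|x|=q^{-1}$, and $\overline K_c$ the completion of an algebraic closure of $K$ (with the extended absolute value). Put $[i]=x^{q^i}-x$, $D_0=1$, $D_i=[i][i-1]^q\cdots[1]^{q^{i-1}}$ for $i\ge 1$, and $$\binom{k}{m}_K=\frac{D_k}{D_m D_{k-m}^{q^m}},\qquad 0\le m\le k .$$ Let $\mathcal F_2$ be the set of germs at the origin of the functions $f(s,t)=\sum_{k\ge 0}\sum_{m=0}^{k}a_{m,k}s^{q^m}t^{q^k}$, $a_{m,k}\in\overline K_c$, given by a series convergent in a neighbourhood of the origin. On $\mathcal F_2$ consider the operators $\tau u=u^q$, $\Delta_t u(s,t)=u(s,xt)-x\,u(s,t)$ and the Carlitz derivative $d_su(s,t)=\bigl(u(xs,t)-x\,u(s,t)\bigr)^{1/q}$. Let $\mathfrak A_2$ be the ring of operators on $\mathcal F_2$ generated by $\tau$, $d_s$, $\Delta_t$ and the multiplications by scalars from $\overline K_c$, and let $\Gamma_\nu\subset\mathfrak A_2$ be the $\overline K_c$-vector space spanned by the operators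 $\tau^l d_s^\mu\Delta_t^i$ with $l+\mu+i\le\nu$. A good filtration of a left $\mathfrak A_2$-module $M$ is an increasing sequence of finite-dimensional $\overline K_c$-subspaces $\mathfrak M_0\subset\mathfrak M_1\subset\cdots$ with union $M$, such that $\Gamma_\nu\mathfrak M_j\subset\mathfrak M_{\nu+j}$ for all $\nu,j\ge 0$, and $\mathfrak M_{i+k}=\Gamma_i\mathfrak M_k$ for all $i\ge 0$ and all sufficiently large $k$. We write $d(M)=d$ if, for a good filtration of $M$, $\dim_{\overline K_c}\mathfrak M_j$ coincides for all large $j$ with the value at $j$ of a polynomial of degree $d$. A germ $f\in\mathcal F_2$ is called quasi-holonomic if $d(\mathfrak A_2/I_f)=2$, where $I_f=\{\varphi\in\mathfrak A_2:\varphi(f)=0\}$. **Proposition 7.** The series $$f(s,t)=\sum_{k=0}^\infty\sum_{m=0}^k\binom{k}{m}_K s^{q^m}t^{q^k}$$ converges for all $s,t\in\overline K_c$ with $|s|<1$, $|t|<1$, and its germ at the origin belongs to $\mathcal F_2$. It satisfies the equation $$d_sf=\Delta_tf+[1]^{1/q}f ,$$ and $f$ is quasi-holonomic. -/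

import Mathlib

open Filter Topology

namespace QuasiHolonomic

noncomputable section

section BaseField

variable (F : Type*) [Field F] [Finite F]

/-- `q`, the number of elements of the finite field `F = 𝔽_q`. -/
abbrev q : ℕ := Nat.card F

theorem one_lt_q : 1 < q F := Finite.one_lt_card

theorem one_lt_q_nnreal : (1 : NNReal) < (q F : NNReal) := by exact_mod_cast one_lt_q F

/-- The field `K = 𝔽_q((x))` carries the absolute value with `|x| = q⁻¹`, that is
`|z| = q^{-m}` if `m` is the order of `z ≠ 0`. -/
instance rankOneLaurent :
    Valuation.RankOne (Valued.v : Valuation (LaurentSeries F) (WithZero (Multiplicative ℤ))) where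
  hom' := (WithZeroMulInt.toNNReal (one_lt_q_nnreal F).ne_zero).comp
    MonoidWithZeroHom.ValueGroup₀.embedding
  strictMono' := (WithZeroMulInt.toNNReal_strictMono (one_lt_q_nnreal F)).comp
    MonoidWithZeroHom.ValueGroup₀.embedding_strictMono
  exists_val_nontrivial := by
    refine ⟨HahnSeries.single 1 1, ?_, ?_⟩
    · rw [LaurentSeries.valuation_single_zpow]; exact WithZero.exp_ne_zero
    · rw [LaurentSeries.valuation_single_zpow, ← WithZero.exp_zero]
      intro h
      have := WithZero.exp_injective h
      omega

instance nontriviallyNormedFieldLaurent : NontriviallyNormedField (LaurentSeries F) :=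
  Valued.toNontriviallyNormedField (LaurentSeries F) (WithZero (Multiplicative ℤ))

instance isUltrametricDistLaurent : IsUltrametricDist (LaurentSeries F) :=
  Valued.instIsUltrametricDist (LaurentSeries F) (WithZero (Multiplicative ℤ))

instance completeSpaceLaurent : CompleteSpace (LaurentSeries F) :=
  LaurentSeries.instLaurentSeriesComplete


/-- An algebraic closure of `K`. -/
abbrev AlgCl : Type _ := AlgebraicClosure (LaurentSeries F)

/-- The unique extension of the absolute value of `K` to its algebraic closure. -/
instance normedFieldAlgCl : NormedField (AlgCl F) :=
  spectralNorm.normedField (LaurentSeries F) (AlgCl F)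

/-- `K̄_c`, the completion of an algebraic closure of `K`. -/
def Kc : Type _ := UniformSpace.Completion (AlgCl F)

instance : NormedField (Kc F) := inferInstanceAs (NormedField (UniformSpace.Completion (AlgCl F)))

instance : CompleteSpace (Kc F) :=
  inferInstanceAs (CompleteSpace (UniformSpace.Completion (AlgCl F)))

/-- The embedding of `K̄` in its completion. -/
def ofAlgCl : AlgCl F →+* Kc F := UniformSpace.Completion.coeRingHom

/-- The embedding of `K` in `K̄_c`. -/
def ofLaurent : LaurentSeries F →+* Kc F :=
  (ofAlgCl F).comp (algebraMap (LaurentSeries F) (AlgCl F))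

/-- The element `x` of `K ⊆ K̄_c`. -/
def varX : Kc F := ofLaurent F (HahnSeries.single 1 1)

theorem norm_ofAlgCl (y : AlgCl F) : ‖ofAlgCl F y‖ = ‖y‖ :=
  UniformSpace.Completion.norm_coe y

theorem norm_ofLaurent (y : LaurentSeries F) : ‖ofLaurent F y‖ = ‖y‖ :=
  (norm_ofAlgCl F _).trans (spectralNorm_extends y)

theorem norm_single (n : ℤ) : ‖(HahnSeries.single n 1 : LaurentSeries F)‖ = (q F : ℝ) ^ (-n) := by
  have h : Valued.v (HahnSeries.single n (1 : F) : LaurentSeries F) = WithZero.exp (-n) :=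
    LaurentSeries.valuation_single_zpow F n
  have h2 : ‖(HahnSeries.single n 1 : LaurentSeries F)‖ =
      (WithZeroMulInt.toNNReal (one_lt_q_nnreal F).ne_zero
        (Valued.v (HahnSeries.single n (1 : F) : LaurentSeries F)) : ℝ) := by
    rw [Valued.toNormedField.norm_def]
    simp [Valuation.RankOne.hom, Valuation.RankLeOne.hom']
  rw [h2, h, WithZeroMulInt.toNNReal_neg_apply _ WithZero.exp_ne_zero]
  rw [NNReal.coe_zpow]
  rfl

theorem norm_varX : ‖varX F‖ = (q F : ℝ)⁻¹ := by
  rw [varX, norm_ofLaurent, norm_single, zpow_neg_one]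

theorem norm_varX_lt_one : ‖varX F‖ < 1 := by
  rw [norm_varX]
  exact inv_lt_one_of_one_lt₀ (by exact_mod_cast one_lt_q F)

theorem add_pow_q (a b : Kc F) : (a + b) ^ q F = a ^ q F + b ^ q F := by
  have := Fintype.ofFinite F
  obtain ⟨p, hp⟩ := CharP.exists F
  obtain ⟨n, hpp, hn⟩ := FiniteField.card F p
  have : Fact p.Prime := ⟨hpp⟩
  have : CharP (Kc F) p :=
    charP_of_injective_ringHom
      (((ofLaurent F).comp (HahnSeries.C (Γ := ℤ) (R := F))).injective) p
  have : ExpChar (Kc F) p := ExpChar.prime hpp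
  have hq : q F = p ^ (n : ℕ) := by rw [q, Nat.card_eq_fintype_card, hn]
  rw [hq, add_pow_expChar_pow]

/-- The Frobenius `λ ↦ λ^q` as a ring homomorphism. -/
def frobHom : Kc F →+* Kc F where
  toFun a := a ^ q F
  map_one' := one_pow _
  map_mul' a b := mul_pow a b _
  map_zero' := zero_pow (one_lt_q F).ne_bot
  map_add' := add_pow_q F

theorem isUniformInducing_frobHom : IsUniformInducing (frobHom F) := by
  have hd : ∀ a b, dist (frobHom F a) (frobHom F b) = dist a b ^ q F := fun a b => by
    rw [dist_eq_norm, ← map_sub, dist_eq_norm]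
    exact norm_pow _ _
  have h0 : q F ≠ 0 := (one_lt_q F).ne_bot
  rw [Metric.isUniformInducing_iff]
  refine ⟨?_, fun δ hδ => ⟨δ ^ q F, pow_pos hδ _, fun {a b} h => ?_⟩⟩
  · rw [Metric.uniformContinuous_iff]
    intro ε hε
    refine ⟨min ε 1, by positivity, fun {a b} h => ?_⟩
    rw [hd]
    calc dist a b ^ q F ≤ dist a b ^ 1 :=
          pow_le_pow_of_le_one dist_nonneg (h.le.trans (min_le_right _ _)) (one_lt_q F).le
      _ < ε := by rw [pow_one]; exact h.trans_le (min_le_left _ _)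
  · rw [hd] at h
    exact lt_of_pow_lt_pow_left₀ _ hδ.le h

theorem frobHom_bijective : Function.Bijective (frobHom F) := by
  refine ⟨(frobHom F).injective, ?_⟩
  have hc : IsClosed (Set.range (frobHom F)) :=
    (isUniformInducing_frobHom F).isComplete_range.isClosed
  have hd : Dense (Set.range (frobHom F)) := by
    refine Dense.mono ?_ (UniformSpace.Completion.denseRange_coe (α := AlgCl F))
    rintro _ ⟨y, rfl⟩
    obtain ⟨z, hz⟩ := IsAlgClosed.exists_pow_nat_eq y (zero_lt_one.trans (one_lt_q F))
    refine ⟨ofAlgCl F z, ?_⟩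
    change ofAlgCl F z ^ q F = ofAlgCl F y
    rw [← map_pow, hz]
  exact Set.range_eq_univ.1 (hc.closure_eq ▸ hd.closure_eq)

/-- The Frobenius automorphism `λ ↦ λ^q` of `K̄_c`; its inverse is the `q`-th root `λ ↦ λ^{1/q}`. -/
def frob : Kc F ≃+* Kc F := RingEquiv.ofBijective (frobHom F) (frobHom_bijective F)

theorem frob_apply (a : Kc F) : frob F a = a ^ q F := rfl

/-- The unique `q`-th root `λ^{1/q}` of an element of `K̄_c`. -/
def qRoot : Kc F ≃+* Kc F := (frob F).symm

theorem qRoot_pow_q (a : Kc F) : qRoot F a ^ q F = a := (frob F).apply_symm_apply a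

theorem continuous_frob : Continuous (frob F) :=
  (isUniformInducing_frobHom F).uniformContinuous.continuous

theorem continuous_qRoot : Continuous (qRoot F) := by
  refine (isUniformInducing_frobHom F).isInducing.continuous_iff.2 ?_
  have : frobHom F ∘ qRoot F = id := funext (qRoot_pow_q F)
  rw [this]
  exact continuous_id

theorem qRoot_pow_q_pow_succ (a : Kc F) (m : ℕ) : qRoot F (a ^ q F ^ (m + 1)) = a ^ q F ^ m := by
  apply (frob F).injective
  rw [frob_apply, frob_apply, qRoot_pow_q, ← pow_mul, pow_succ]

/-- `[i] = x^{q^i} - x`. -/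
def bracket (i : ℕ) : Kc F := varX F ^ q F ^ i - varX F

/-- The Carlitz factorial `D_i = [i][i-1]^q ⋯ [1]^{q^{i-1}}`, `D_0 = 1`. -/
def carlitzFactorial (i : ℕ) : Kc F := ∏ j ∈ Finset.range i, bracket F (i - j) ^ q F ^ j

/-- The `K`-binomial coefficient `D_k / (D_m D_{k-m}^{q^m})`, `0 ≤ m ≤ k`, extended by zero to
`m > k`. -/
def kBinom (k m : ℕ) : Kc F :=
  if m ≤ k then
    carlitzFactorial F k / (carlitzFactorial F m * carlitzFactorial F (k - m) ^ q F ^ m)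
  else 0

end BaseField

section Germs

variable (F : Type*) [Field F] [Finite F]

/-- Germs at the origin of functions of two variables `s`, `t`. -/
abbrev Germ2 : Type _ := Germ (𝓝 (0 : Kc F × Kc F)) (Kc F)

variable {F}

/-- The germ `u` is represented, near the origin, by the convergent series
`∑_k ∑_{m ≤ k} a_{m,k} s^{q^m} t^{q^k}`. -/
def HasExpansion (a : ℕ → ℕ → Kc F) (u : Germ2 F) : Prop :=
  (∀ m k, k < m → a m k = 0) ∧ ∃ g : Kc F × Kc F → Kc F, u = (g : Germ2 F) ∧
    ∃ r : ℝ, 0 < r ∧ ∀ s t : Kc F, ‖s‖ < r → ‖t‖ < r →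
      HasSum (fun p : ℕ × ℕ => a p.1 p.2 * s ^ q F ^ p.1 * t ^ q F ^ p.2) (g (s, t))

theorem hasSum_congr {f g : ℕ × ℕ → Kc F} {c : Kc F} (h : ∀ p, f p = g p) :
    HasSum f c ↔ HasSum g c := by
  rw [funext h]

theorem HasExpansion.add {a b : ℕ → ℕ → Kc F} {u v : Germ2 F} (hu : HasExpansion a u)
    (hv : HasExpansion b v) : HasExpansion (fun m k => a m k + b m k) (u + v) := by
  obtain ⟨ha, g, rfl, r, hr, hg⟩ := hu
  obtain ⟨hb, h, rfl, r', hr', hh⟩ := hv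
  refine ⟨fun m k hmk => by simp only [ha m k hmk, hb m k hmk, add_zero], g + h, rfl, min r r',
    lt_min hr hr', fun s t hs ht => ?_⟩
  refine (hasSum_congr fun p => ?_).1
    ((hg s t (hs.trans_le (min_le_left _ _)) (ht.trans_le (min_le_left _ _))).add
    (hh s t (hs.trans_le (min_le_right _ _)) (ht.trans_le (min_le_right _ _))))
  ring

theorem HasExpansion.smul {a : ℕ → ℕ → Kc F} {u : Germ2 F} (hu : HasExpansion a u) (c : Kc F) :
    HasExpansion (fun m k => c * a m k) (c • u) := by
  obtain ⟨ha, g, rfl, r, hr, hg⟩ := hu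
  refine ⟨fun m k hmk => by simp only [ha m k hmk, mul_zero], c • g, rfl, r, hr, fun s t hs ht => ?_⟩
  refine (hasSum_congr fun p => ?_).1 ((hg s t hs ht).mul_left c)
  ring

theorem HasExpansion.zero : HasExpansion (fun _ _ => (0 : Kc F)) (0 : Germ2 F) :=
  ⟨fun _ _ _ => rfl, fun _ => 0, rfl, 1, one_pos, fun s t _ _ => by simp⟩

variable (F)

/-- Multiplication of the variable `s` by `x`. -/
def scaleS (z : Kc F × Kc F) : Kc F × Kc F := (varX F * z.1, z.2)

/-- Multiplication of the variable `t` by `x`. -/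
def scaleT (z : Kc F × Kc F) : Kc F × Kc F := (z.1, varX F * z.2)

theorem tendsto_scaleS : Tendsto (scaleS F) (𝓝 0) (𝓝 0) := by
  have : Continuous (scaleS F) := by unfold scaleS; fun_prop
  simpa [scaleS, Prod.zero_eq_mk] using this.tendsto 0

theorem tendsto_scaleT : Tendsto (scaleT F) (𝓝 0) (𝓝 0) := by
  have : Continuous (scaleT F) := by unfold scaleT; fun_prop
  simpa [scaleT, Prod.zero_eq_mk] using this.tendsto 0

/-- `τ u = u^q`. -/
def tauGerm : Germ2 F →+ Germ2 F where
  toFun u := u.map (fun y => y ^ q F)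
  map_zero' := congrArg (fun g : Kc F × Kc F → Kc F => (g : Germ2 F))
    (funext fun _ => zero_pow (one_lt_q F).ne_bot)
  map_add' u v := by
    refine Germ.inductionOn₂ u v fun g h => ?_
    exact congrArg (fun g : Kc F × Kc F → Kc F => (g : Germ2 F)) (funext fun _ => add_pow_q F _ _)

/-- `Δ_s u (s, t) = u (x s, t) - x u (s, t)`. -/
def deltaSGerm : Germ2 F →+ Germ2 F where
  toFun u := u.compTendsto (scaleS F) (tendsto_scaleS F) - varX F • u
  map_zero' := congrArg (fun g : Kc F × Kc F → Kc F => (g : Germ2 F))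
    (funext fun _ => by simp)
  map_add' u v := by
    refine Germ.inductionOn₂ u v fun g h => ?_
    exact congrArg (fun g : Kc F × Kc F → Kc F => (g : Germ2 F)) (funext fun _ => by simp; ring)

/-- `Δ_t u (s, t) = u (s, x t) - x u (s, t)`. -/
def deltaTGerm : Germ2 F →+ Germ2 F where
  toFun u := u.compTendsto (scaleT F) (tendsto_scaleT F) - varX F • u
  map_zero' := congrArg (fun g : Kc F × Kc F → Kc F => (g : Germ2 F))
    (funext fun _ => by simp)
  map_add' u v := by
    refine Germ.inductionOn₂ u v fun g h => ?_
    exact congrArg (fun g : Kc F × Kc F → Kc F => (g : Germ2 F)) (funext fun _ => by simp; ring)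

/-- The pointwise `q`-th root of a germ, the inverse of `τ`. -/
def qRootGerm : Germ2 F →+ Germ2 F where
  toFun u := u.map (qRoot F)
  map_zero' := congrArg (fun g : Kc F × Kc F → Kc F => (g : Germ2 F))
    (funext fun _ => map_zero (qRoot F))
  map_add' u v := by
    refine Germ.inductionOn₂ u v fun g h => ?_
    exact congrArg (fun g : Kc F × Kc F → Kc F => (g : Germ2 F)) (funext fun _ => map_add (qRoot F) _ _)

/-- The Carlitz derivative `d_s = τ⁻¹ Δ_s`. -/
def dGerm : Germ2 F →+ Germ2 F := (qRootGerm F).comp (deltaSGerm F)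

variable {F}

theorem injective_shift : Function.Injective fun p : ℕ × ℕ => (p.1 + 1, p.2 + 1) :=
  fun p p' h => by
    simp only [Prod.mk.injEq] at h
    exact Prod.ext (by omega) (by omega)

theorem HasExpansion.tau {a : ℕ → ℕ → Kc F} {u : Germ2 F} (hu : HasExpansion a u) :
    ∃ b, HasExpansion b (tauGerm F u) := by
  obtain ⟨ha, g, rfl, r, hr, hg⟩ := hu
  let b : ℕ → ℕ → Kc F := fun m k =>
    if 1 ≤ m ∧ 1 ≤ k then a (m - 1) (k - 1) ^ q F else 0
  refine ⟨b, fun m k hmk => ?_, fun z => g z ^ q F, rfl, r, hr, fun s t hs ht => ?_⟩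
  · by_cases h : 1 ≤ m ∧ 1 ≤ k
    · simp only [b, if_pos h]
      rw [ha _ _ (by omega), zero_pow (one_lt_q F).ne_bot]
    · simp only [b, if_neg h]
  · refine (injective_shift.hasSum_iff ?_).1
      ((hasSum_congr fun p => ?_).1 ((hg s t hs ht).map (frob F) (continuous_frob F)))
    · rintro ⟨m, k⟩ hp
      have h : ¬(1 ≤ m ∧ 1 ≤ k) := fun h => hp ⟨(m - 1, k - 1), by
        ext <;> dsimp only <;> omega⟩
      simp only [b, if_neg h, zero_mul]
    · have h : 1 ≤ p.1 + 1 ∧ 1 ≤ p.2 + 1 := ⟨by omega, by omega⟩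
      simp only [b, Function.comp_apply, if_pos h, Nat.add_sub_cancel, map_mul, frob_apply]
      rw [← pow_mul, ← pow_mul, ← pow_succ, ← pow_succ]

theorem HasExpansion.deltaT {a : ℕ → ℕ → Kc F} {u : Germ2 F} (hu : HasExpansion a u) :
    HasExpansion (fun m k => bracket F k * a m k) (deltaTGerm F u) := by
  obtain ⟨ha, g, rfl, r, hr, hg⟩ := hu
  refine ⟨fun m k hmk => by simp only [ha m k hmk, mul_zero],
    fun z => g (scaleT F z) - varX F * g z, rfl, r, hr, fun s t hs ht => ?_⟩
  have ht' : ‖varX F * t‖ < r := by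
    rw [norm_mul]
    exact (mul_le_of_le_one_left (norm_nonneg t) (norm_varX_lt_one F).le).trans_lt ht
  refine (hasSum_congr fun p => ?_).1
    ((hg s (varX F * t) hs ht').sub ((hg s t hs ht).mul_left (varX F)))
  simp only [bracket]
  ring

theorem HasExpansion.d {a : ℕ → ℕ → Kc F} {u : Germ2 F} (hu : HasExpansion a u) :
    HasExpansion (fun m k => qRoot F (bracket F (m + 1) * a (m + 1) (k + 1))) (dGerm F u) := by
  obtain ⟨ha, g, rfl, r, hr, hg⟩ := hu
  refine ⟨fun m k hmk => by
      simp only [ha (m + 1) (k + 1) (by omega), mul_zero, map_zero],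
    fun z => qRoot F (g (scaleS F z) - varX F * g z), rfl, r, hr, fun s t hs ht => ?_⟩
  have hs' : ‖varX F * s‖ < r := by
    rw [norm_mul]
    exact (mul_le_of_le_one_left (norm_nonneg s) (norm_varX_lt_one F).le).trans_lt hs
  refine (hasSum_congr fun p => ?_).1 ((injective_shift.hasSum_iff ?_).2
    (((hg (varX F * s) t hs' ht).sub ((hg s t hs ht).mul_left (varX F))).map (qRoot F)
      (continuous_qRoot F)))
  · simp only [Function.comp_apply]
    rw [← qRoot_pow_q_pow_succ F s p.1, ← qRoot_pow_q_pow_succ F t p.2, ← map_mul, ← map_mul, bracket]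
    congr 1
    ring
  · rintro ⟨m, k⟩ hp
    have h : m = 0 ∨ k < m := by
      by_contra h
      exact hp ⟨(m - 1, k - 1), by ext <;> dsimp only <;> omega⟩
    simp only [Function.comp_apply]
    rw [map_eq_zero_iff _ (qRoot F).injective]
    rcases h with rfl | h
    · ring
    · rw [ha m k h]
      ring

variable (F)

/-- `𝓕₂`: the germs of the functions `∑_k ∑_{m ≤ k} a_{m,k} s^{q^m} t^{q^k}` given by a series which
converges in a neighbourhood of the origin. -/
def F2 : Submodule (Kc F) (Germ2 F) where
  carrier := {u | ∃ a, HasExpansion a u}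
  add_mem' := fun ⟨_, ha⟩ ⟨_, hb⟩ => ⟨_, ha.add hb⟩
  zero_mem' := ⟨_, HasExpansion.zero⟩
  smul_mem' := fun c _ ⟨_, ha⟩ => ⟨_, ha.smul c⟩

/-- The operator `τ` on `𝓕₂`. -/
def tau : AddMonoid.End (F2 F) :=
  ((tauGerm F).comp (F2 F).toAddSubgroup.subtype).codRestrict (F2 F).toAddSubgroup
    fun u => let ⟨_, ha⟩ := u.2; ha.tau

/-- The operator `d_s` on `𝓕₂`. -/
def dS : AddMonoid.End (F2 F) :=
  ((dGerm F).comp (F2 F).toAddSubgroup.subtype).codRestrict (F2 F).toAddSubgroup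
    fun u => let ⟨_, ha⟩ := u.2; ⟨_, ha.d⟩

/-- The operator `Δ_t` on `𝓕₂`. -/
def deltaT : AddMonoid.End (F2 F) :=
  ((deltaTGerm F).comp (F2 F).toAddSubgroup.subtype).codRestrict (F2 F).toAddSubgroup
    fun u => let ⟨_, ha⟩ := u.2; ⟨_, ha.deltaT⟩

end Germs

section CarlitzRing

variable (F : Type*) [Field F] [Finite F]

/-- The operator of multiplication by a scalar `λ ∈ K̄_c` on `𝓕₂`. -/
def scalar : Kc F →+* AddMonoid.End (F2 F) := Module.toAddMonoidEnd (Kc F) (F2 F)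

/-- The Carlitz ring `𝔄₂`: the ring of operators on `𝓕₂` generated by `τ`, `d_s`, `Δ_t` and the
operators of multiplication by scalars. -/
def A2 : Subring (AddMonoid.End (F2 F)) :=
  Subring.closure ({tau F, dS F, deltaT F} ∪ Set.range (scalar F))

/-- `τ` as an element of `𝔄₂`. -/
def A2.tau : A2 F := ⟨QuasiHolonomic.tau F, Subring.subset_closure (by simp)⟩

/-- `d_s` as an element of `𝔄₂`. -/
def A2.d : A2 F := ⟨dS F, Subring.subset_closure (by simp)⟩

/-- `Δ_t` as an element of `𝔄₂`. -/
def A2.delta : A2 F := ⟨deltaT F, Subring.subset_closure (by simp)⟩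

/-- The scalars as elements of `𝔄₂`. -/
def A2.scalar : Kc F →+* A2 F :=
  (QuasiHolonomic.scalar F).codRestrict (A2 F) fun c => Subring.subset_closure (by simp)

/-- `𝔄₂` as a vector space over `K̄_c`, scalars multiplying from the left. -/
instance moduleA2 : Module (Kc F) (A2 F) := Module.compHom (A2 F) (A2.scalar F)

instance isScalarTowerA2 : IsScalarTower (Kc F) (A2 F) (A2 F) :=
  ⟨fun c a b => mul_assoc (A2.scalar F c) a b⟩

instance isScalarTowerF2 : IsScalarTower (Kc F) (A2 F) (F2 F) :=
  ⟨fun _ _ _ => rfl⟩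

/-- The filtration `Γ_ν` of `𝔄₂`: the `K̄_c`-vector space spanned by the operators
`τ^l d_s^μ Δ_t^i` with `l + μ + i ≤ ν`. -/
def Gam (ν : ℕ) : Submodule (Kc F) (A2 F) :=
  Submodule.span (Kc F)
    {a | ∃ l μ i : ℕ, l + μ + i ≤ ν ∧ a = A2.tau F ^ l * A2.d F ^ μ * A2.delta F ^ i}

end CarlitzRing

section Dimension

variable {F : Type*} [Field F] [Finite F]

/-- A good filtration `𝔐₀ ⊆ 𝔐₁ ⊆ ⋯` of a left `𝔄₂`-module `M`: an exhaustive filtration by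
finite-dimensional `K̄_c`-subspaces with `Γ_ν 𝔐_j ⊆ 𝔐_{ν+j}` for all `ν`, `j` and
`𝔐_{i+k} = Γ_i 𝔐_k` for all `i` and all large `k`.
(The vector space structure of `M` is the one coming from the scalars of `𝔄₂`.) -/
structure IsGoodFiltration {M : Type*} [AddCommGroup M] [Module (A2 F) M] [Module (Kc F) M]
    [IsScalarTower (Kc F) (A2 F) M] (𝔐 : ℕ → Submodule (Kc F) M) : Prop where
  mono : Monotone 𝔐
  exhaustive : ∀ v : M, ∃ j, v ∈ 𝔐 j
  finite : ∀ j, FiniteDimensional (Kc F) (𝔐 j)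
  smul_mem : ∀ ν j, ∀ a ∈ Gam F ν, ∀ v ∈ 𝔐 j, a • v ∈ 𝔐 (ν + j)
  good : ∃ k₀, ∀ k, k₀ ≤ k → ∀ i,
    𝔐 (i + k) = Submodule.span (Kc F) {w | ∃ a ∈ Gam F i, ∃ v ∈ 𝔐 k, w = a • v}

/-- `d(M) = d`: for a good filtration of the left `𝔄₂`-module `M` the dimension of `𝔐_j` equals,
for all large `j`, the value at `j` of a polynomial of degree `d`. -/
def HasDimension (F : Type*) [Field F] [Finite F] (M : Type*) [AddCommGroup M] [Module (A2 F) M]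
    [Module (Kc F) M] [IsScalarTower (Kc F) (A2 F) M] (d : ℕ) : Prop :=
  ∃ 𝔐 : ℕ → Submodule (Kc F) M, IsGoodFiltration 𝔐 ∧
    ∃ χ : Polynomial ℚ, χ.natDegree = d ∧
      ∃ N : ℕ, ∀ j, N ≤ j → (Module.finrank (Kc F) (𝔐 j) : ℚ) = χ.eval (j : ℚ)

/-- A left `𝔄₂`-module `M` is quasi-holonomic if `d(M) = 2`. -/
def IsQuasiHolonomicModule (F : Type*) [Field F] [Finite F] (M : Type*) [AddCommGroup M]
    [Module (A2 F) M] [Module (Kc F) M] [IsScalarTower (Kc F) (A2 F) M] : Prop :=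
  HasDimension F M 2

/-- The left ideal `I_f = {φ ∈ 𝔄₂ : φ(f) = 0}`. -/
def annihilator (f : F2 F) : Submodule (A2 F) (A2 F) :=
  LinearMap.ker (LinearMap.toSpanSingleton (A2 F) (F2 F) f)

/-- `f ∈ 𝓕₂` is quasi-holonomic if the left module `M_f = 𝔄₂ / I_f` is. -/
def IsQuasiHolonomic (f : F2 F) : Prop :=
  IsQuasiHolonomicModule F (A2 F ⧸ annihilator f)

end Dimension

section GeneratingFunction

variable (F : Type*) [Field F] [Finite F]

/-- The generating function `f(s,t) = ∑_k ∑_{m ≤ k} binom(k,m)_K s^{q^m} t^{q^k}`. -/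
def kBinomGenFun (z : Kc F × Kc F) : Kc F :=
  ∑' k : ℕ, ∑ m ∈ Finset.range (k + 1), kBinom F k m * z.1 ^ q F ^ m * z.2 ^ q F ^ k

end GeneratingFunction

end

end QuasiHolonomic

namespace QuasiHolonomic

noncomputable section

/-! ### Absolute values and recurrences of the `K`-binomial coefficients -/

section Binomials

variable (F : Type*) [Field F] [Finite F]

/-! All brackets `[i]` with `i ≥ 1` have the same absolute value, so `|D_{m+n}| = |D_m| |D_n|^{q^m}`
and the `K`-binomials are bounded by 1; convergence on the open unit polydisc follows by comparison
with a product of geometric series. An expansion is determined by its germ (`HasExpansion.unique`),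
so operator identities on `𝓕₂` may be checked on coefficients. The differential equation then
amounts to the recurrence `bracket_mul_kBinom_succ` together with `[k+1]^{1/q} = [k] + [1]^{1/q}`.

For quasi-holonomicity, the commutation relations of `τ`, `d_s`, `Δ_t` make `Γ` an exhaustive ring
filtration, and `Γ_j f` is carried by a good filtration of `𝔄₂/I_f ≅ 𝔄₂ f`. The equation replaces
each `d_s` by a first-order polynomial in `Δ_t`, hence `Γ_j f` is spanned by the `τ^l Δ_t^i f` with
`l + i ≤ j` (`cyclicFiltration_kBinomGerm`). These germs are linearly independent
(`linearIndependent_orbit`): they are triangular in `l`, and for fixed `l` a relation gives a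
polynomial with infinitely many roots. So the dimension is exactly `(j+1)(j+2)/2`, of degree 2 in
`j`. -/

theorem varX_ne_zero : varX F ≠ 0 := by
  rw [← norm_pos_iff, norm_varX]
  exact inv_pos.2 (by exact_mod_cast zero_lt_one.trans (one_lt_q F))

theorem norm_bracket {i : ℕ} (hi : i ≠ 0) : ‖bracket F i‖ = (q F : ℝ)⁻¹ := by
  have hx : ‖(HahnSeries.single 1 1 : LaurentSeries F)‖ = (q F : ℝ)⁻¹ := by
    rw [norm_single, zpow_neg_one]
  -- `[i]` lies in `K`, so its size can be found there, where the ultrametric inequality is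
  -- available.
  have h : bracket F i = ofLaurent F
      ((HahnSeries.single 1 1 : LaurentSeries F) ^ q F ^ i - HahnSeries.single 1 1) := by
    rw [bracket, map_sub, map_pow]
    rfl
  have hlt : ‖(HahnSeries.single 1 1 : LaurentSeries F) ^ q F ^ i‖ <
      ‖(HahnSeries.single 1 1 : LaurentSeries F)‖ := by
    rw [norm_pow]
    refine pow_lt_self_of_lt_one₀ ?_ ?_ (Nat.one_lt_pow hi (one_lt_q F))
    · rw [hx]; exact inv_pos.2 (by exact_mod_cast zero_lt_one.trans (one_lt_q F))
    · rw [hx]; exact inv_lt_one_of_one_lt₀ (by exact_mod_cast one_lt_q F)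
  rw [h, norm_ofLaurent, ← hx, sub_eq_add_neg,
    IsUltrametricDist.norm_add_eq_max_of_norm_ne_norm (by rw [norm_neg]; exact hlt.ne), norm_neg,
    max_eq_right hlt.le]

theorem bracket_ne_zero {i : ℕ} (hi : i ≠ 0) : bracket F i ≠ 0 := by
  rw [← norm_pos_iff, norm_bracket F hi]
  exact inv_pos.2 (by exact_mod_cast zero_lt_one.trans (one_lt_q F))

theorem bracket_injective : Function.Injective (bracket F) := by
  intro i j h
  have h2 : ‖varX F‖ ^ q F ^ i = ‖varX F‖ ^ q F ^ j := by
    rw [← norm_pow, ← norm_pow, sub_left_injective h]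
  exact Nat.pow_right_injective (one_lt_q F)
    (pow_right_injective₀ (norm_pos_iff.2 (varX_ne_zero F)) (norm_varX_lt_one F).ne h2)

@[simp]
theorem bracket_zero : bracket F 0 = 0 := by simp [bracket]

/-- Frobenius is additive, so it sends `[k]` to `x^{q^{k+1}} - x^q`. Every commutation relation
below that involves `[1]` comes from this. -/
theorem bracket_pow_q (k : ℕ) : bracket F k ^ q F + bracket F 1 = bracket F (k + 1) := by
  have h : bracket F k ^ q F = (varX F ^ q F ^ k) ^ q F - varX F ^ q F :=
    map_sub (frob F) _ _
  rw [h, bracket, bracket, ← pow_mul, ← pow_succ]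
  ring

@[simp]
theorem qRoot_pow (a : Kc F) : qRoot F (a ^ q F) = a := (frob F).symm_apply_apply a

theorem qRoot_bracket_succ (k : ℕ) :
    qRoot F (bracket F (k + 1)) = bracket F k + qRoot F (bracket F 1) := by
  rw [← bracket_pow_q, map_add, qRoot_pow]

@[simp]
theorem carlitzFactorial_zero : carlitzFactorial F 0 = 1 := by simp [carlitzFactorial]

theorem carlitzFactorial_succ (i : ℕ) :
    carlitzFactorial F (i + 1) = bracket F (i + 1) * carlitzFactorial F i ^ q F := by
  rw [carlitzFactorial, Finset.prod_range_succ', carlitzFactorial, ← Finset.prod_pow, mul_comm]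
  congr 1
  · simp
  · refine Finset.prod_congr rfl fun j _ => ?_
    rw [← pow_mul, pow_succ, Nat.add_sub_add_right]

theorem carlitzFactorial_ne_zero (i : ℕ) : carlitzFactorial F i ≠ 0 := by
  induction i with
  | zero => simp
  | succ i ih =>
    rw [carlitzFactorial_succ]
    exact mul_ne_zero (bracket_ne_zero F i.succ_ne_zero) (pow_ne_zero _ ih)

/-- In `D_{i+1} = [i+1] D_i^q` the norm of the first factor does not depend on `i`, so both sides
obey the same recursion in `m`. It gives the denominator of a binomial the norm of its numerator. -/
theorem norm_carlitzFactorial_add (m n : ℕ) :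
    ‖carlitzFactorial F (m + n)‖ = ‖carlitzFactorial F m‖ * ‖carlitzFactorial F n‖ ^ q F ^ m := by
  induction m with
  | zero => simp
  | succ m ih =>
    rw [Nat.add_right_comm, carlitzFactorial_succ, carlitzFactorial_succ, norm_mul, norm_mul,
      norm_pow, norm_pow, ih, norm_bracket F (Nat.succ_ne_zero _),
      norm_bracket F (Nat.succ_ne_zero _), mul_pow, ← pow_mul, ← pow_succ, mul_assoc]

theorem kBinom_of_lt {k m : ℕ} (h : k < m) : kBinom F k m = 0 := if_neg h.not_ge

@[simp]
theorem kBinom_zero_right (k : ℕ) : kBinom F k 0 = 1 := by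
  simp [kBinom, carlitzFactorial_ne_zero]

theorem norm_kBinom_le_one (k m : ℕ) : ‖kBinom F k m‖ ≤ 1 := by
  rcases lt_or_ge k m with h | h
  · simp [kBinom_of_lt F h]
  · obtain ⟨n, rfl⟩ := Nat.exists_eq_add_of_le h
    rw [kBinom, if_pos h, norm_div, norm_mul, norm_pow, Nat.add_sub_cancel_left,
      ← norm_carlitzFactorial_add]
    exact div_self_le_one _

theorem bracket_mul_kBinom_succ (k m : ℕ) :
    bracket F (m + 1) * kBinom F (k + 1) (m + 1) = bracket F (k + 1) * kBinom F k m ^ q F := by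
  rcases lt_or_ge k m with h | h
  · rw [kBinom_of_lt F h, kBinom_of_lt F (by omega), zero_pow (one_lt_q F).ne_bot]
    ring
  · rw [kBinom, if_pos (by omega), kBinom, if_pos h, carlitzFactorial_succ, carlitzFactorial_succ,
      Nat.add_sub_add_right, div_pow, mul_pow, ← pow_mul, ← pow_succ]
    have h1 := bracket_ne_zero F m.succ_ne_zero
    have h2 := carlitzFactorial_ne_zero F m
    have h3 := carlitzFactorial_ne_zero F (k - m)
    field_simp

theorem qRoot_bracket_mul_kBinom_succ (k m : ℕ) :
    qRoot F (bracket F (m + 1) * kBinom F (k + 1) (m + 1)) =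
      (bracket F k + qRoot F (bracket F 1)) * kBinom F k m := by
  rw [bracket_mul_kBinom_succ, map_mul, qRoot_pow, qRoot_bracket_succ]

variable {F}

theorem summable_norm_pow_q_pow {s : Kc F} (hs : ‖s‖ < 1) :
    Summable fun m : ℕ => ‖s‖ ^ q F ^ m :=
  (summable_geometric_of_lt_one (norm_nonneg s) hs).comp_injective
    (Nat.pow_right_injective (one_lt_q F))

theorem summable_kBinom {s t : Kc F} (hs : ‖s‖ < 1) (ht : ‖t‖ < 1) :
    Summable fun p : ℕ × ℕ => kBinom F p.2 p.1 * s ^ q F ^ p.1 * t ^ q F ^ p.2 := by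
  refine Summable.of_norm_bounded ((summable_norm_pow_q_pow hs).mul_of_nonneg
    (summable_norm_pow_q_pow ht) (fun _ => by positivity) fun _ => by positivity) fun p => ?_
  rw [norm_mul, norm_mul, norm_pow, norm_pow]
  gcongr
  exact mul_le_of_le_one_left (by positivity) (norm_kBinom_le_one F _ _)

theorem hasSum_kBinomGenFun {s t : Kc F} (hs : ‖s‖ < 1) (ht : ‖t‖ < 1) :
    HasSum (fun p : ℕ × ℕ => kBinom F p.2 p.1 * s ^ q F ^ p.1 * t ^ q F ^ p.2)
      (kBinomGenFun F (s, t)) := by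
  have h := (summable_kBinom hs ht).hasSum
  -- The swap makes `k` the outer index; the inner sum is finite because the binomials vanish for `m
  -- > k`.
  have h2 := ((Equiv.prodComm ℕ ℕ).hasSum_iff.2 h).prod_fiberwise
    (g := fun k => ∑ m ∈ Finset.range (k + 1), kBinom F k m * s ^ q F ^ m * t ^ q F ^ k)
    fun k => hasSum_sum_of_ne_finset_zero fun m hm => by
      simp [kBinom_of_lt F (show k < m by simpa using hm)]
  rw [kBinomGenFun, h2.tsum_eq]
  exact h

theorem hasExpansion_kBinomGenFun :
    HasExpansion (fun m k => kBinom F k m) (kBinomGenFun F : Germ2 F) :=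
  ⟨fun _ _ h => kBinom_of_lt F h, kBinomGenFun F, rfl, 1, one_pos,
    fun _ _ hs ht => hasSum_kBinomGenFun hs ht⟩

end Binomials

/-! ### Uniqueness of expansions and coefficient functionals -/

section Uniqueness

variable {F : Type*} [Field F] [Finite F]

variable (F) in
/-- `K̄_c` as a nontrivially normed field. -/
abbrev nontriviallyNormedFieldKc : NontriviallyNormedField (Kc F) :=
  NontriviallyNormedField.ofNormNeOne ⟨varX F, varX_ne_zero F, (norm_varX_lt_one F).ne⟩

theorem eq_zero_of_hasSum_pow_q_pow {b : ℕ → Kc F} {r : ℝ} (hr : 0 < r)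
    (h : ∀ t : Kc F, ‖t‖ < r → HasSum (fun k => b k * t ^ q F ^ k) 0) : b = 0 := by
  let := nontriviallyNormedFieldKc F
  have hinj : Function.Injective fun k => q F ^ k := Nat.pow_right_injective (one_lt_q F)
  -- Coefficients are zero at exponents that are not powers of `q`, which gives an ordinary power
  -- series to which the identity theorem applies.
  let c : ℕ → Kc F := Function.extend (fun k => q F ^ k) b 0
  have hp : HasFPowerSeriesAt (0 : Kc F → Kc F) (FormalMultilinearSeries.ofScalars (Kc F) c) 0 := by
    rw [hasFPowerSeriesAt_iff]
    filter_upwards [Metric.ball_mem_nhds (0 : Kc F) hr] with t ht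
    simp only [FormalMultilinearSeries.coeff_ofScalars, Pi.zero_apply]
    refine (hinj.hasSum_iff fun n hn => ?_).1
      ((h t (by simpa using ht)).congr_fun ?_)
    · simp [c, Function.extend_apply' _ _ _ hn]
    · intro k
      simp [c, hinj.extend_apply, mul_comm]
  funext k
  have := congrArg (fun p => FormalMultilinearSeries.coeff p (q F ^ k)) hp.eq_zero
  rw [FormalMultilinearSeries.coeff_ofScalars] at this
  exact (hinj.extend_apply b 0 k).symm.trans this

/-- The one-variable identity theorem is used twice: in `t` for each fixed small `s`, then in `s` on
each coefficient of `t^{q^k}`, which is a finite sum since `m ≤ k`. -/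
theorem HasExpansion.eq_zero {a : ℕ → ℕ → Kc F} (h : HasExpansion a (0 : Germ2 F)) (m k : ℕ) :
    a m k = 0 := by
  obtain ⟨ha, g, hg, r, hr, hs⟩ := h
  have hev : ∀ᶠ z in 𝓝 (0 : Kc F × Kc F), g z = 0 := (Germ.coe_eq.1 hg).mono fun _ h => h.symm
  obtain ⟨ε, hε, hball⟩ := Metric.eventually_nhds_iff.1 hev
  have key : ∀ s : Kc F, ‖s‖ < min r ε →
      (fun k => ∑ m ∈ Finset.range (k + 1), a m k * s ^ q F ^ m) = 0 := fun s hsr =>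
    eq_zero_of_hasSum_pow_q_pow (lt_min hr hε) fun t htr => by
      have h0 : g (s, t) = 0 := hball (by
        rw [dist_zero_right]
        exact max_lt (hsr.trans_le (min_le_right _ _)) (htr.trans_le (min_le_right _ _)))
      have h1 := hs s t (hsr.trans_le (min_le_left _ _)) (htr.trans_le (min_le_left _ _))
      rw [h0] at h1
      refine ((Equiv.prodComm ℕ ℕ).hasSum_iff.2 h1).prod_fiberwise fun k => ?_
      rw [Finset.sum_mul]
      exact hasSum_sum_of_ne_finset_zero fun m hm => by
        simp [ha m k (by simpa using hm)]
  refine congrFun (eq_zero_of_hasSum_pow_q_pow (b := fun m => a m k) (lt_min hr hε)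
    fun s hsr => ?_) m
  rw [← show _ = (0 : Kc F) from congrFun (key s hsr) k]
  exact hasSum_sum_of_ne_finset_zero fun m hm => by simp [ha m k (by simpa using hm)]

theorem HasExpansion.unique {a b : ℕ → ℕ → Kc F} {u : Germ2 F} (ha : HasExpansion a u)
    (hb : HasExpansion b u) (m k : ℕ) : a m k = b m k := by
  have h := ha.add (hb.smul (-1))
  rw [neg_one_smul, add_neg_cancel] at h
  linear_combination h.eq_zero m k

theorem HasExpansion.eq {a : ℕ → ℕ → Kc F} {u v : Germ2 F} (hu : HasExpansion a u)
    (hv : HasExpansion a v) : u = v := by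
  obtain ⟨-, g, rfl, r, hr, hg⟩ := hu
  obtain ⟨-, h, rfl, r', hr', hh⟩ := hv
  refine Germ.coe_eq.2 (Metric.eventually_nhds_iff.2 ⟨min r r', lt_min hr hr', fun z hz => ?_⟩)
  rw [dist_zero_right] at hz
  have h1 : ‖z.1‖ < min r r' := (norm_fst_le z).trans_lt hz
  have h2 : ‖z.2‖ < min r r' := (norm_snd_le z).trans_lt hz
  exact (hg z.1 z.2 (h1.trans_le (min_le_left _ _)) (h2.trans_le (min_le_left _ _))).unique
    (hh z.1 z.2 (h1.trans_le (min_le_right _ _)) (h2.trans_le (min_le_right _ _)))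

/-- The coefficient of `τ u` at `s^{q^m} t^{q^k}`. -/
def tauCoeff (a : ℕ → ℕ → Kc F) : ℕ → ℕ → Kc F
  | m + 1, k + 1 => a m k ^ q F
  | _, _ => 0

/-- `HasExpansion.tau` gives only the existence of an expansion; the coefficient calculus needs to
know which one. -/
theorem HasExpansion.tau_explicit {a : ℕ → ℕ → Kc F} {u : Germ2 F} (hu : HasExpansion a u) :
    HasExpansion (tauCoeff a) (tauGerm F u) := by
  obtain ⟨ha, g, rfl, r, hr, hg⟩ := hu
  refine ⟨fun m k hmk => ?_, fun z => g z ^ q F, rfl, r, hr, fun s t hs ht => ?_⟩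
  · rcases m with _ | m <;> rcases k with _ | k
    · rfl
    · rfl
    · rfl
    · rw [tauCoeff, ha _ _ (by omega), zero_pow (one_lt_q F).ne_bot]
  · refine (injective_shift.hasSum_iff ?_).1
      ((hasSum_congr fun p => ?_).1 ((hg s t hs ht).map (frob F) (continuous_frob F)))
    · rintro ⟨m, k⟩ hp
      rcases m with _ | m <;> rcases k with _ | k
      · simp [tauCoeff]
      · simp [tauCoeff]
      · simp [tauCoeff]
      · exact absurd ⟨(m, k), rfl⟩ hp
    · simp only [Function.comp_apply, tauCoeff, map_mul, frob_apply]
      rw [← pow_mul, ← pow_mul, ← pow_succ, ← pow_succ]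

/-- The coefficient at `s^{q^m} t^{q^k}` as a linear functional on `𝓕₂`. -/
def coeff (m k : ℕ) : F2 F →ₗ[Kc F] Kc F where
  toFun u := u.2.choose m k
  -- Expansions are chosen separately for `u`, `v` and `u + v`; uniqueness makes the choices
  -- compatible.
  map_add' u v := (u + v).2.choose_spec.unique (u.2.choose_spec.add v.2.choose_spec) m k
  map_smul' c u := (c • u).2.choose_spec.unique (u.2.choose_spec.smul c) m k

theorem hasExpansion_coeff (u : F2 F) : HasExpansion (fun m k => coeff m k u) (u : Germ2 F) :=
  u.2.choose_spec

theorem HasExpansion.coeff_eq {a : ℕ → ℕ → Kc F} {u : F2 F} (h : HasExpansion a (u : Germ2 F))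
    (m k : ℕ) : coeff m k u = a m k := (hasExpansion_coeff u).unique h m k

theorem coeff_of_lt {m k : ℕ} (h : k < m) (u : F2 F) : coeff m k u = 0 :=
  (hasExpansion_coeff u).1 m k h

theorem ext_coeff {u v : F2 F} (h : ∀ m k, coeff m k u = coeff m k v) : u = v := by
  have hv := hasExpansion_coeff v
  simp only [← h] at hv
  exact Subtype.ext ((hasExpansion_coeff u).eq hv)

@[simp]
theorem coeff_tau_succ (m k : ℕ) (u : F2 F) :
    coeff (m + 1) (k + 1) (tau F u) = coeff m k u ^ q F :=
  HasExpansion.coeff_eq (u := tau F u) (hasExpansion_coeff u).tau_explicit _ _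

@[simp]
theorem coeff_tau_zero (k : ℕ) (u : F2 F) : coeff 0 k (tau F u) = 0 :=
  HasExpansion.coeff_eq (u := tau F u) (hasExpansion_coeff u).tau_explicit _ _

@[simp]
theorem coeff_dS (m k : ℕ) (u : F2 F) :
    coeff m k (dS F u) = qRoot F (bracket F (m + 1) * coeff (m + 1) (k + 1) u) :=
  HasExpansion.coeff_eq (u := dS F u) (hasExpansion_coeff u).d _ _

@[simp]
theorem coeff_deltaT (m k : ℕ) (u : F2 F) :
    coeff m k (deltaT F u) = bracket F k * coeff m k u :=
  HasExpansion.coeff_eq (u := deltaT F u) (hasExpansion_coeff u).deltaT _ _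

variable (F) in
/-- The generating function of the `K`-binomial coefficients as an element of `𝓕₂`. -/
def kBinomGerm : F2 F := ⟨(kBinomGenFun F : Germ2 F), _, hasExpansion_kBinomGenFun⟩

@[simp]
theorem coeff_kBinomGerm (m k : ℕ) : coeff m k (kBinomGerm F) = kBinom F k m :=
  HasExpansion.coeff_eq (u := kBinomGerm F) hasExpansion_kBinomGenFun m k

variable (F) in
theorem dS_kBinomGerm : dS F (kBinomGerm F) =
    deltaT F (kBinomGerm F) + qRoot F (bracket F 1) • kBinomGerm F :=
  ext_coeff fun m k => by
    rw [coeff_dS, map_add, map_smul, coeff_deltaT]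
    simp only [coeff_kBinomGerm]
    rw [qRoot_bracket_mul_kBinom_succ, smul_eq_mul]
    ring

end Uniqueness

/-! ### Semilinear maps and spans -/

section Semilinear

/-- An additive map that is semilinear for some map of the scalars maps the span of a set into every
subspace that contains the image of the set. -/
theorem map_mem_of_mem_span {R V W : Type*} [Semiring R] [AddCommMonoid V] [Module R V]
    [AddCommMonoid W] [Module R W] (g : V →+ W) (σ : R → R) (hg : ∀ c v, g (c • v) = σ c • g v)
    {S : Set V} {N : Submodule R W} (h : ∀ v ∈ S, g v ∈ N) {v : V}
    (hv : v ∈ Submodule.span R S) : g v ∈ N := by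
  induction hv using Submodule.span_induction with
  | mem v hv => exact h v hv
  | zero => rw [map_zero]; exact N.zero_mem
  | add v w _ _ hv hw => rw [map_add]; exact N.add_mem hv hw
  | smul c v _ hv => rw [hg]; exact N.smul_mem _ hv

end Semilinear

/-! ### Commutation relations in the Carlitz ring -/

section Relations

variable {F : Type*} [Field F] [Finite F]

theorem coeff_smul (m k : ℕ) (c : Kc F) (u : F2 F) :
    coeff m k (c • u) = c * coeff m k u := (coeff m k).map_smul c u

theorem tau_smul (c : Kc F) (u : F2 F) : tau F (c • u) = c ^ q F • tau F u :=
  ext_coeff fun m k => by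
    rcases m with _ | m
    · rw [coeff_smul, coeff_tau_zero, coeff_tau_zero, mul_zero]
    · rcases k with _ | k
      · rw [coeff_of_lt m.succ_pos, coeff_of_lt m.succ_pos]
      · rw [coeff_smul, coeff_tau_succ, coeff_tau_succ, coeff_smul, mul_pow]

theorem dS_smul (c : Kc F) (u : F2 F) : dS F (c • u) = qRoot F c • dS F u :=
  ext_coeff fun m k => by
    rw [coeff_smul, coeff_dS, coeff_dS, coeff_smul, ← map_mul, mul_left_comm]

theorem deltaT_smul (c : Kc F) (u : F2 F) : deltaT F (c • u) = c • deltaT F u :=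
  ext_coeff fun m k => by
    rw [coeff_smul, coeff_deltaT, coeff_deltaT, coeff_smul, mul_left_comm]

/-- On the coefficient `a_{m,k}`, `d_s τ` acts as `[m+1]^{1/q} = [m] + [1]^{1/q}` and `τ d_s` as
`[m]`; for `m = 0` the latter vanishes, in accordance with `[0] = 0`. -/
theorem dS_tau (u : F2 F) :
    dS F (tau F u) = tau F (dS F u) + qRoot F (bracket F 1) • u :=
  ext_coeff fun m k => by
    rw [map_add, coeff_dS, coeff_tau_succ, map_mul, qRoot_pow, qRoot_bracket_succ, coeff_smul]
    rcases m with _ | m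
    · rw [coeff_tau_zero, bracket_zero, zero_add, zero_add]
    · rcases k with _ | k
      · rw [coeff_of_lt m.succ_pos, coeff_of_lt m.succ_pos, mul_zero, mul_zero, zero_add]
      · rw [coeff_tau_succ, coeff_dS, qRoot_pow_q]
        ring

theorem deltaT_tau (u : F2 F) :
    deltaT F (tau F u) = tau F (deltaT F u) + bracket F 1 • tau F u :=
  ext_coeff fun m k => by
    rw [map_add, coeff_deltaT, coeff_smul]
    rcases m with _ | m
    · simp
    · rcases k with _ | k
      · simp only [coeff_of_lt m.succ_pos, mul_zero, mul_zero, add_zero]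
      · rw [coeff_tau_succ, coeff_tau_succ, coeff_deltaT, ← bracket_pow_q]
        ring

theorem dS_deltaT (u : F2 F) :
    dS F (deltaT F u) = deltaT F (dS F u) + qRoot F (bracket F 1) • dS F u :=
  ext_coeff fun m k => by
    rw [map_add, coeff_dS, coeff_deltaT, coeff_deltaT, coeff_smul, coeff_dS, mul_left_comm, map_mul,
      qRoot_bracket_succ]
    ring

theorem A2.smul_def (c : Kc F) (a : A2 F) : c • a = A2.scalar F c * a := rfl

theorem A2.tau_mul_smul (c : Kc F) (a : A2 F) :
    A2.tau F * (c • a) = c ^ q F • (A2.tau F * a) :=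
  Subtype.ext (AddMonoidHom.ext fun u => tau_smul c (a.1 u))

theorem A2.d_mul_smul (c : Kc F) (a : A2 F) :
    A2.d F * (c • a) = qRoot F c • (A2.d F * a) :=
  Subtype.ext (AddMonoidHom.ext fun u => dS_smul c (a.1 u))

theorem A2.delta_mul_smul (c : Kc F) (a : A2 F) :
    A2.delta F * (c • a) = c • (A2.delta F * a) :=
  Subtype.ext (AddMonoidHom.ext fun u => deltaT_smul c (a.1 u))

/-- The trailing factor `a` lets the relation act on the leftmost letters of a longer word, as the
inductions on monomials require. -/
theorem A2.d_mul_tau_mul (a : A2 F) :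
    A2.d F * (A2.tau F * a) = A2.tau F * (A2.d F * a) + qRoot F (bracket F 1) • a :=
  Subtype.ext (AddMonoidHom.ext fun u => dS_tau (a.1 u))

theorem A2.delta_mul_tau_mul (a : A2 F) :
    A2.delta F * (A2.tau F * a) = A2.tau F * (A2.delta F * a) + bracket F 1 • (A2.tau F * a) :=
  Subtype.ext (AddMonoidHom.ext fun u => deltaT_tau (a.1 u))

theorem A2.d_mul_delta_mul (a : A2 F) :
    A2.d F * (A2.delta F * a) =
      A2.delta F * (A2.d F * a) + qRoot F (bracket F 1) • (A2.d F * a) :=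
  Subtype.ext (AddMonoidHom.ext fun u => dS_deltaT (a.1 u))

end Relations

/-! ### `Γ` as an exhaustive filtration of the ring -/

section Filtration

variable {F : Type*} [Field F] [Finite F]

variable (F) in
/-- The operator `τ^l d_s^μ Δ_t^i`. -/
def monomialOp (l μ i : ℕ) : A2 F := A2.tau F ^ l * A2.d F ^ μ * A2.delta F ^ i

theorem monomialOp_mem {l μ i ν : ℕ} (h : l + μ + i ≤ ν) : monomialOp F l μ i ∈ Gam F ν :=
  Submodule.subset_span ⟨l, μ, i, h, rfl⟩

theorem monomialOp_succ_left (l μ i : ℕ) :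
    monomialOp F (l + 1) μ i = A2.tau F * monomialOp F l μ i := by
  simp only [monomialOp, pow_succ', mul_assoc]

theorem monomialOp_zero_succ (μ i : ℕ) :
    monomialOp F 0 (μ + 1) i = A2.d F * monomialOp F 0 μ i := by
  simp only [monomialOp, pow_succ', pow_zero, one_mul, mul_assoc]

theorem monomialOp_zero_zero_succ (i : ℕ) :
    monomialOp F 0 0 (i + 1) = A2.delta F * monomialOp F 0 0 i := by
  simp only [monomialOp, pow_succ', pow_zero, one_mul]

theorem Gam_mono : Monotone (Gam F) := fun _ _ h =>
  Submodule.span_mono fun _ ⟨l, μ, i, hl, ha⟩ => ⟨l, μ, i, hl.trans h, ha⟩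

theorem tau_mul_mem {ν : ℕ} {a : A2 F} (ha : a ∈ Gam F ν) : A2.tau F * a ∈ Gam F (ν + 1) := by
  refine map_mem_of_mem_span (AddMonoidHom.mulLeft (A2.tau F)) (· ^ q F) A2.tau_mul_smul ?_ ha
  rintro _ ⟨l, μ, i, h, rfl⟩
  change A2.tau F * monomialOp F l μ i ∈ _
  rw [← monomialOp_succ_left]
  exact monomialOp_mem (by omega)

/-- Moving `d_s` to the right past each `τ` restores the normal order; each exchange costs a scalar
multiple of a monomial shorter by two letters. -/
theorem d_mul_mem {ν : ℕ} {a : A2 F} (ha : a ∈ Gam F ν) : A2.d F * a ∈ Gam F (ν + 1) := by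
  refine map_mem_of_mem_span (AddMonoidHom.mulLeft (A2.d F)) (qRoot F) A2.d_mul_smul ?_ ha
  rintro _ ⟨l, μ, i, h, rfl⟩
  change A2.d F * monomialOp F l μ i ∈ _
  clear ha
  induction l generalizing ν with
  | zero =>
    rw [← monomialOp_zero_succ]
    exact monomialOp_mem (by omega)
  | succ l ih =>
    obtain ⟨ν, rfl⟩ : ∃ n, ν = n + 1 := ⟨ν - 1, by omega⟩
    rw [monomialOp_succ_left, A2.d_mul_tau_mul]
    exact add_mem (tau_mul_mem (ih (by omega)))
      (Submodule.smul_mem _ _ (monomialOp_mem (by omega)))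

theorem delta_mul_mem {ν : ℕ} {a : A2 F} (ha : a ∈ Gam F ν) :
    A2.delta F * a ∈ Gam F (ν + 1) := by
  refine map_mem_of_mem_span (AddMonoidHom.mulLeft (A2.delta F)) id A2.delta_mul_smul ?_ ha
  rintro _ ⟨l, μ, i, h, rfl⟩
  change A2.delta F * monomialOp F l μ i ∈ _
  clear ha
  induction l generalizing ν with
  | zero =>
    induction μ generalizing ν with
    | zero =>
      rw [← monomialOp_zero_zero_succ]
      exact monomialOp_mem (by omega)
    | succ μ ih =>
      obtain ⟨ν, rfl⟩ : ∃ n, ν = n + 1 := ⟨ν - 1, by omega⟩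
      -- The relation is solved for `Δ_t d_s = d_s Δ_t - [1]^{1/q} d_s`, so that `d_mul_mem` handles
      -- the main term.
      rw [monomialOp_zero_succ, eq_sub_of_add_eq (A2.d_mul_delta_mul _).symm,
        ← monomialOp_zero_succ]
      exact sub_mem (d_mul_mem (ih (by omega)))
        (Submodule.smul_mem _ _ (monomialOp_mem (by omega)))
  | succ l ih =>
    obtain ⟨ν, rfl⟩ : ∃ n, ν = n + 1 := ⟨ν - 1, by omega⟩
    rw [monomialOp_succ_left, A2.delta_mul_tau_mul, ← monomialOp_succ_left]
    exact add_mem (tau_mul_mem (ih (by omega)))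
      (Submodule.smul_mem _ _ (monomialOp_mem (by omega)))

theorem pow_mul_mem {b : A2 F} (hb : ∀ ν, ∀ a ∈ Gam F ν, b * a ∈ Gam F (ν + 1)) (n : ℕ) {ν : ℕ}
    {a : A2 F} (ha : a ∈ Gam F ν) : b ^ n * a ∈ Gam F (n + ν) := by
  induction n with
  | zero => simpa using ha
  | succ n ih =>
    rw [pow_succ', mul_assoc, Nat.add_right_comm]
    exact hb _ _ ih

theorem mul_mem_Gam {ν j : ℕ} {a b : A2 F} (ha : a ∈ Gam F ν) (hb : b ∈ Gam F j) :
    a * b ∈ Gam F (ν + j) := by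
  refine map_mem_of_mem_span (AddMonoidHom.mulRight b) id (fun c a => smul_mul_assoc c a b) ?_ ha
  rintro _ ⟨l, μ, i, h, rfl⟩
  change A2.tau F ^ l * A2.d F ^ μ * A2.delta F ^ i * b ∈ _
  rw [mul_assoc, mul_assoc]
  exact Gam_mono (by omega) (pow_mul_mem (fun _ _ => tau_mul_mem) l
    (pow_mul_mem (fun _ _ => d_mul_mem) μ (pow_mul_mem (fun _ _ => delta_mul_mem) i hb)))

theorem one_mem_Gam (ν : ℕ) : (1 : A2 F) ∈ Gam F ν := by
  have := monomialOp_mem (F := F) (show 0 + 0 + 0 ≤ ν by omega)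
  simpa [monomialOp] using this

theorem exists_mem_Gam (a : A2 F) : ∃ ν, a ∈ Gam F ν := by
  obtain ⟨a, ha⟩ := a
  induction ha using Subring.closure_induction with
  | mem a ha =>
    rcases ha with (rfl | rfl | rfl) | ⟨c, rfl⟩
    · refine ⟨1, ?_⟩
      change A2.tau F ∈ _
      simpa [monomialOp] using monomialOp_mem (F := F) (le_refl (1 + 0 + 0))
    · refine ⟨1, ?_⟩
      change A2.d F ∈ _
      simpa [monomialOp] using monomialOp_mem (F := F) (le_refl (0 + 1 + 0))
    · refine ⟨1, ?_⟩
      change A2.delta F ∈ _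
      simpa [monomialOp] using monomialOp_mem (F := F) (le_refl (0 + 0 + 1))
    · refine ⟨0, ?_⟩
      have := Submodule.smul_mem _ c (one_mem_Gam (F := F) 0)
      rwa [A2.smul_def, mul_one] at this
  | zero => exact ⟨0, zero_mem _⟩
  | one => exact ⟨0, one_mem_Gam 0⟩
  | add a b ha hb iha ihb =>
    obtain ⟨m, hm⟩ := iha
    obtain ⟨n, hn⟩ := ihb
    exact ⟨max m n, add_mem (Gam_mono (le_max_left m n) hm) (Gam_mono (le_max_right m n) hn)⟩
  | neg a ha iha =>
    obtain ⟨m, hm⟩ := iha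
    exact ⟨m, neg_mem hm⟩
  | mul a b ha hb iha ihb =>
    obtain ⟨m, hm⟩ := iha
    obtain ⟨n, hn⟩ := ihb
    exact ⟨m + n, mul_mem_Gam hm hn⟩

/-- The word is cut after its first `i` letters, so no commutation is needed. The cases say in which
block the cut falls; the `min` covers words shorter than `i`. -/
theorem exists_split_monomial {G : Type*} [Monoid G] (x y z : G) {l μ n i k : ℕ}
    (h : l + μ + n ≤ i + k) : ∃ l₁ μ₁ n₁ l₂ μ₂ n₂ : ℕ, l₁ + μ₁ + n₁ ≤ i ∧ l₂ + μ₂ + n₂ ≤ k ∧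
      x ^ l₁ * y ^ μ₁ * z ^ n₁ * (x ^ l₂ * y ^ μ₂ * z ^ n₂) = x ^ l * y ^ μ * z ^ n := by
  rcases le_total i l with hl | hl
  · refine ⟨i, 0, 0, l - i, μ, n, by omega, by omega, ?_⟩
    simp only [pow_zero, mul_one, ← mul_assoc]
    rw [← pow_add, Nat.add_sub_cancel' hl]
  rcases le_total i (l + μ) with hm | hm
  · refine ⟨l, i - l, 0, 0, μ - (i - l), n, by omega, by omega, ?_⟩
    simp only [pow_zero, mul_one, one_mul, mul_assoc]
    rw [← mul_assoc (y ^ (i - l)), ← pow_add, Nat.add_sub_cancel' (show i - l ≤ μ by omega)]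
  · refine ⟨l, μ, min n (i - (l + μ)), 0, 0, n - min n (i - (l + μ)), by omega, by omega, ?_⟩
    simp only [pow_zero, one_mul, mul_assoc]
    rw [← pow_add, Nat.add_sub_cancel' (min_le_left _ _)]

theorem exists_mul_eq_monomialOp {l μ n i k : ℕ} (h : l + μ + n ≤ i + k) :
    ∃ a ∈ Gam F i, ∃ b ∈ Gam F k, a * b = monomialOp F l μ n := by
  obtain ⟨l₁, μ₁, n₁, l₂, μ₂, n₂, h₁, h₂, e⟩ :=
    exists_split_monomial (A2.tau F) (A2.d F) (A2.delta F) h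
  exact ⟨_, monomialOp_mem h₁, _, monomialOp_mem h₂, e⟩

instance finiteDimensional_Gam (ν : ℕ) : FiniteDimensional (Kc F) (Gam F ν) := by
  refine FiniteDimensional.span_of_finite (Kc F) (Set.Finite.subset
    (((Set.finite_Iic ν).prod ((Set.finite_Iic ν).prod (Set.finite_Iic ν))).image
      fun p : ℕ × ℕ × ℕ => monomialOp F p.1 p.2.1 p.2.2) ?_)
  rintro _ ⟨l, μ, i, h, rfl⟩
  exact ⟨(l, μ, i), ⟨show l ≤ ν by omega, show μ ≤ ν by omega, show i ≤ ν by omega⟩, rfl⟩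

end Filtration

/-! ### Good filtrations of cyclic modules -/

section CyclicModule

variable {F : Type*} [Field F] [Finite F] {M : Type*} [AddCommGroup M] [Module (A2 F) M]
  [Module (Kc F) M] [IsScalarTower (Kc F) (A2 F) M]

variable (F) in
/-- The filtration `Γ_j v` of the cyclic module generated by `v`. -/
def cyclicFiltration (v : M) (j : ℕ) : Submodule (Kc F) M :=
  (Gam F j).map ((LinearMap.toSpanSingleton (A2 F) M v).restrictScalars (Kc F))

theorem mem_cyclicFiltration {v w : M} {j : ℕ} :
    w ∈ cyclicFiltration F v j ↔ ∃ a ∈ Gam F j, a • v = w := Iff.rfl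

theorem smul_mem_cyclicFiltration {v : M} {ν j : ℕ} {a : A2 F} (ha : a ∈ Gam F ν) {w : M}
    (hw : w ∈ cyclicFiltration F v j) : a • w ∈ cyclicFiltration F v (ν + j) := by
  obtain ⟨b, hb, rfl⟩ := mem_cyclicFiltration.1 hw
  exact mem_cyclicFiltration.2 ⟨a * b, mul_mem_Gam ha hb, mul_smul a b v⟩

theorem cyclicFiltration_eq_span (v : M) (j : ℕ) : cyclicFiltration F v j =
    Submodule.span (Kc F) {w | ∃ l μ i : ℕ, l + μ + i ≤ j ∧ w = monomialOp F l μ i • v} := by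
  rw [cyclicFiltration, Gam, Submodule.map_span]
  congr 1
  ext w
  constructor
  · rintro ⟨_, ⟨l, μ, i, h, rfl⟩, rfl⟩
    exact ⟨l, μ, i, h, rfl⟩
  · rintro ⟨l, μ, i, h, rfl⟩
    exact ⟨_, ⟨l, μ, i, h, rfl⟩, rfl⟩

theorem cyclicFiltration_add (v : M) (i k : ℕ) :
    cyclicFiltration F v (i + k) = Submodule.span (Kc F)
      {w | ∃ a ∈ Gam F i, ∃ u ∈ cyclicFiltration F v k, w = a • u} := by
  refine le_antisymm ?_ (Submodule.span_le.2 ?_)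
  · rw [cyclicFiltration_eq_span, Submodule.span_le]
    rintro _ ⟨l, μ, n, h, rfl⟩
    obtain ⟨a, ha, b, hb, hab⟩ := exists_mul_eq_monomialOp (F := F) h
    rw [← hab]
    exact Submodule.subset_span
      ⟨a, ha, b • v, mem_cyclicFiltration.2 ⟨b, hb, rfl⟩, mul_smul a b v⟩
  · rintro _ ⟨a, ha, u, hu, rfl⟩
    exact smul_mem_cyclicFiltration ha hu

theorem isGoodFiltration_cyclicFiltration {v : M} (hv : ∀ w : M, ∃ a : A2 F, a • v = w) :
    IsGoodFiltration (cyclicFiltration F v) where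
  mono _ _ h := Submodule.map_mono (Gam_mono h)
  exhaustive w := by
    obtain ⟨a, rfl⟩ := hv w
    obtain ⟨j, hj⟩ := exists_mem_Gam a
    exact ⟨j, mem_cyclicFiltration.2 ⟨a, hj, rfl⟩⟩
  finite j := by
    unfold cyclicFiltration
    infer_instance
  smul_mem _ _ _ ha _ hw := smul_mem_cyclicFiltration ha hw
  good := ⟨0, fun k _ i => cyclicFiltration_add v i k⟩

/-- This transfers the dimension count from the quotient `𝔄₂/I_f` to germs in `𝓕₂`, where
coefficients can be used. -/
theorem finrank_cyclicFiltration_of_injective {N : Type*} [AddCommGroup N] [Module (A2 F) N]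
    [Module (Kc F) N] [IsScalarTower (Kc F) (A2 F) N] (L : M →ₗ[A2 F] N)
    (hL : Function.Injective L) (v : M) (j : ℕ) :
    Module.finrank (Kc F) (cyclicFiltration F v j) =
      Module.finrank (Kc F) (cyclicFiltration F (L v) j) := by
  have h : (cyclicFiltration F v j).map (L.restrictScalars (Kc F)) =
      cyclicFiltration F (L v) j := by
    rw [cyclicFiltration, cyclicFiltration, ← Submodule.map_comp]
    congr 1
    ext a
    exact map_smul L a v
  rw [← h]
  exact (Submodule.equivMapOfInjective (L.restrictScalars (Kc F)) hL _).finrank_eq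

end CyclicModule

/-! ### Linear independence of the germs `τ^l Δ_t^i f` -/

section Independence

variable {F : Type*} [Field F] [Finite F]

variable (F) in
/-- The germ `τ^l Δ_t^i f` of the generating function `f` of the `K`-binomial coefficients. -/
def orbit (p : ℕ × ℕ) : F2 F := (tau F ^ p.1) ((deltaT F ^ p.2) (kBinomGerm F))

theorem coeff_deltaT_pow (i m k : ℕ) (u : F2 F) :
    coeff m k ((deltaT F ^ i) u) = bracket F k ^ i * coeff m k u := by
  induction i with
  | zero => simp
  | succ i ih =>
    rw [pow_succ', AddMonoid.End.coe_mul, Function.comp_apply, coeff_deltaT, ih]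
    ring

theorem coeff_tau_pow_of_lt {l m : ℕ} (h : m < l) (k : ℕ) (u : F2 F) :
    coeff m k ((tau F ^ l) u) = 0 := by
  induction l generalizing m k with
  | zero => omega
  | succ l ih =>
    rw [pow_succ', AddMonoid.End.coe_mul, Function.comp_apply]
    rcases m with _ | m
    · rw [coeff_tau_zero]
    · rcases k with _ | k
      · exact coeff_of_lt m.succ_pos _
      · rw [coeff_tau_succ, ih (by omega), zero_pow (one_lt_q F).ne_bot]

theorem coeff_tau_pow (l k : ℕ) (u : F2 F) :
    coeff l (l + k) ((tau F ^ l) u) = coeff 0 k u ^ q F ^ l := by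
  induction l with
  | zero => simp
  | succ l ih =>
    rw [pow_succ', AddMonoid.End.coe_mul, Function.comp_apply, Nat.add_right_comm, coeff_tau_succ, ih, ← pow_mul,
      ← pow_succ]

theorem coeff_orbit_of_lt {l i m : ℕ} (h : m < l) (k : ℕ) : coeff m k (orbit F (l, i)) = 0 :=
  coeff_tau_pow_of_lt h k _

/-- The lowest row of `τ^l Δ_t^i f` comes from row 0 of `Δ_t^i f`, whose entries are `[k]^i` because
`binom(k,0)_K = 1`. -/
theorem coeff_orbit (l i k : ℕ) :
    coeff l (l + k) (orbit F (l, i)) = (bracket F k ^ q F ^ l) ^ i := by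
  rw [orbit, coeff_tau_pow, coeff_deltaT_pow, coeff_kBinomGerm, kBinom_zero_right, mul_one,
    ← pow_mul, ← pow_mul, mul_comm]

theorem pow_q_pow_injective (l : ℕ) : Function.Injective fun a : Kc F => a ^ q F ^ l := by
  induction l with
  | zero => exact fun a b h => by simpa using h
  | succ l ih =>
    intro a b hab
    simp only [pow_succ, pow_mul] at hab
    exact ih ((frob F).injective hab)

theorem bracket_pow_injective (l : ℕ) : Function.Injective fun k => bracket F k ^ q F ^ l :=
  (pow_q_pow_injective l).comp (bracket_injective F)

variable (F) in
theorem linearIndependent_orbit : LinearIndependent (Kc F) (orbit F) := by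
  rw [linearIndependent_iff']
  intro s c hc
  suffices h : ∀ l i, (l, i) ∈ s → c (l, i) = 0 from fun p hp => h p.1 p.2 hp
  intro l
  induction l using Nat.strong_induction_on with
  | _ l ih =>
    -- In row `l` of the relation, terms with larger first index vanish and those with smaller one
    -- have zero coefficient by induction. What remains says that `P` vanishes at `[k]^{q^l}` for
    -- every `k`, and these points are distinct.
    let P : Polynomial (Kc F) :=
      ∑ p ∈ s.filter (fun p => p.1 = l), Polynomial.monomial p.2 (c p)
    have hP : P = 0 := by
      refine Polynomial.eq_zero_of_infinite_isRoot P
        ((Set.infinite_range_of_injective (bracket_pow_injective (F := F) l)).mono ?_)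
      rintro _ ⟨k, rfl⟩
      have h := congrArg (coeff l (l + k)) hc
      rw [map_sum, map_zero] at h
      change P.eval _ = 0
      rw [Polynomial.eval_finsetSum, Finset.sum_filter]
      refine (Finset.sum_congr rfl fun p hp => ?_).trans h
      obtain ⟨l', i⟩ := p
      rw [map_smul, smul_eq_mul]
      rcases lt_trichotomy l' l with hl | rfl | hl
      · rw [if_neg hl.ne, ih l' hl i hp, zero_mul]
      · rw [if_pos rfl, coeff_orbit, Polynomial.eval_monomial]
      · rw [if_neg hl.ne', coeff_orbit_of_lt hl, mul_zero]
    intro i hi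
    have h := congrArg (fun Q => Polynomial.coeff Q i) hP
    simp only [P, Polynomial.finsetSum_coeff, Polynomial.coeff_monomial,
      Polynomial.coeff_zero] at h
    have hmem : (l, i) ∈ s.filter (fun p => p.1 = l) := Finset.mem_filter.2 ⟨hi, rfl⟩
    rw [Finset.sum_eq_single_of_mem _ hmem, if_pos rfl] at h
    · exact h
    · rintro ⟨l', i'⟩ hp hne
      refine if_neg ?_
      rintro rfl
      exact hne (Prod.ext (Finset.mem_filter.1 hp).2 rfl)

end Independence

/-! ### Counting lattice points in a triangle -/

section Count

/-- The pairs `(l, i)` with `l + i ≤ j`. -/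
def pairsLE (j : ℕ) : Finset (ℕ × ℕ) := (Finset.range (j + 1)).biUnion Finset.HasAntidiagonal.antidiagonal

theorem mem_pairsLE {j : ℕ} {p : ℕ × ℕ} : p ∈ pairsLE j ↔ p.1 + p.2 ≤ j := by
  simp [pairsLE]

theorem card_pairsLE (j : ℕ) : ((pairsLE j).card : ℚ) = (j + 1) * (j + 2) / 2 := by
  rw [pairsLE, Finset.card_biUnion]
  · induction j with
    | zero => simp
    | succ j ih =>
      rw [Finset.sum_range_succ, Nat.cast_add, ih, Finset.Nat.card_antidiagonal]
      push_cast
      ring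
  · intro a _ b _ hab
    refine Finset.disjoint_left.2 fun p hp hp' => hab ?_
    rw [Finset.HasAntidiagonal.mem_antidiagonal] at hp hp'
    exact hp.symm.trans hp'

theorem natDegree_simplexPolynomial :
    (Polynomial.C (1 / 2 : ℚ) * (Polynomial.X + Polynomial.C 1) *
      (Polynomial.X + Polynomial.C 2)).natDegree = 2 := by
  compute_degree!

end Count

/-! ### The module generated by `f` and its dimension -/

section GeneratingFunctionModule

variable {F : Type*} [Field F] [Finite F]

theorem tau_pow_smul (l : ℕ) (c : Kc F) (u : F2 F) :
    (tau F ^ l) (c • u) = c ^ q F ^ l • (tau F ^ l) u := by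
  induction l with
  | zero => simp
  | succ l ih =>
    rw [pow_succ', AddMonoid.End.coe_mul, Function.comp_apply, ih, tau_smul, ← pow_mul,
      ← pow_succ]
    rfl

variable (F) in
/-- The span of the germs `Δ_t^i f` with `i ≤ n`, for the generating function `f`. -/
def deltaSpan (n : ℕ) : Submodule (Kc F) (F2 F) :=
  Submodule.span (Kc F) ((fun i => (deltaT F ^ i) (kBinomGerm F)) '' Set.Iic n)

theorem deltaT_pow_mem_deltaSpan {i n : ℕ} (h : i ≤ n) :
    (deltaT F ^ i) (kBinomGerm F) ∈ deltaSpan F n := Submodule.subset_span ⟨i, h, rfl⟩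

theorem deltaSpan_mono : Monotone (deltaSpan F) := fun _ _ h =>
  Submodule.span_mono (Set.image_mono (Set.Iic_subset_Iic.2 h))

theorem deltaT_mem_deltaSpan {n : ℕ} {u : F2 F} (hu : u ∈ deltaSpan F n) :
    deltaT F u ∈ deltaSpan F (n + 1) := by
  refine map_mem_of_mem_span (deltaT F) id deltaT_smul ?_ hu
  rintro _ ⟨i, hi, rfl⟩
  have h := deltaT_pow_mem_deltaSpan (F := F) (Nat.succ_le_succ hi)
  rwa [pow_succ', AddMonoid.End.coe_mul] at h

/-- With `c = [1]^{1/q}`, `d_s Δ_t = (Δ_t + c) d_s` and `d_s f = (Δ_t + c) f`, so the germ is in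
fact `(Δ_t + c)^{i+1} f`. -/
theorem dS_deltaT_pow_mem_deltaSpan (i : ℕ) :
    dS F ((deltaT F ^ i) (kBinomGerm F)) ∈ deltaSpan F (i + 1) := by
  induction i with
  | zero =>
    have h := deltaT_pow_mem_deltaSpan (F := F) (Nat.zero_le 1)
    have h' := deltaT_pow_mem_deltaSpan (F := F) (le_refl 1)
    rw [pow_one] at h'
    have e := dS_kBinomGerm F
    rw [pow_zero, AddMonoid.End.coe_one, id_eq] at h ⊢
    rw [e]
    exact add_mem h' (Submodule.smul_mem _ _ h)
  | succ i ih =>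
    rw [pow_succ', AddMonoid.End.coe_mul, Function.comp_apply, dS_deltaT]
    exact add_mem (deltaT_mem_deltaSpan ih)
      (Submodule.smul_mem _ _ (deltaSpan_mono (Nat.le_succ _) ih))

theorem dS_mem_deltaSpan {n : ℕ} {u : F2 F} (hu : u ∈ deltaSpan F n) :
    dS F u ∈ deltaSpan F (n + 1) := by
  refine map_mem_of_mem_span (dS F) (qRoot F) dS_smul ?_ hu
  rintro _ ⟨i, hi, rfl⟩
  exact deltaSpan_mono (Nat.succ_le_succ hi) (dS_deltaT_pow_mem_deltaSpan i)

theorem dS_pow_deltaT_pow_mem_deltaSpan (μ i : ℕ) :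
    (dS F ^ μ) ((deltaT F ^ i) (kBinomGerm F)) ∈ deltaSpan F (μ + i) := by
  induction μ with
  | zero => simpa using deltaT_pow_mem_deltaSpan (le_refl i)
  | succ μ ih =>
    rw [pow_succ', AddMonoid.End.coe_mul, Function.comp_apply, Nat.add_right_comm]
    exact dS_mem_deltaSpan ih

theorem monomialOp_smul (l μ i : ℕ) (u : F2 F) :
    monomialOp F l μ i • u = (tau F ^ l) ((dS F ^ μ) ((deltaT F ^ i) u)) := rfl

theorem cyclicFiltration_kBinomGerm (j : ℕ) : cyclicFiltration F (kBinomGerm F) j =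
    Submodule.span (Kc F) (Set.range fun p : pairsLE j => orbit F p) := by
  rw [cyclicFiltration_eq_span]
  refine le_antisymm (Submodule.span_le.2 ?_) (Submodule.span_mono ?_)
  · rintro _ ⟨l, μ, i, h, rfl⟩
    rw [monomialOp_smul]
    -- All `d_s` have been traded for `Δ_t` without raising the total degree; the outer `τ^l` only
    -- twists scalars.
    refine map_mem_of_mem_span (tau F ^ l) (· ^ q F ^ l) (tau_pow_smul l) ?_
      (dS_pow_deltaT_pow_mem_deltaSpan μ i)
    rintro _ ⟨n, hn, rfl⟩
    refine Submodule.subset_span ⟨⟨(l, n), mem_pairsLE.2 ?_⟩, rfl⟩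
    have : n ≤ μ + i := hn
    dsimp only
    omega
  · rintro _ ⟨⟨⟨l, i⟩, hp⟩, rfl⟩
    refine ⟨l, 0, i, mem_pairsLE.1 hp, ?_⟩
    rw [monomialOp_smul, pow_zero]
    rfl

theorem finrank_cyclicFiltration_kBinomGerm (j : ℕ) :
    Module.finrank (Kc F) (cyclicFiltration F (kBinomGerm F) j) = (pairsLE j).card := by
  have h : LinearIndependent (Kc F) fun p : pairsLE j => orbit F p :=
    (linearIndependent_orbit F).comp _ Subtype.val_injective
  rw [cyclicFiltration_kBinomGerm, finrank_span_eq_card h, Fintype.card_coe]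

theorem exists_smul_mkQ_one_eq {R : Type*} [Ring R] (I : Submodule R R) (w : R ⧸ I) :
    ∃ a : R, a • I.mkQ 1 = w := by
  obtain ⟨a, rfl⟩ := I.mkQ_surjective w
  exact ⟨a, by rw [← map_smul, smul_eq_mul, mul_one]⟩

theorem exists_injective_of_ker_toSpanSingleton {R M : Type*} [Ring R] [AddCommGroup M]
    [Module R M] (v : M) :
    ∃ L : (R ⧸ LinearMap.ker (LinearMap.toSpanSingleton R M v)) →ₗ[R] M, Function.Injective L ∧
      L ((LinearMap.ker (LinearMap.toSpanSingleton R M v)).mkQ 1) = v :=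
  ⟨Submodule.liftQ _ _ le_rfl, LinearMap.ker_eq_bot.1 (Submodule.ker_liftQ_eq_bot _ _ _ le_rfl),
    one_smul R v⟩

variable (F) in
theorem isQuasiHolonomic_kBinomGerm : IsQuasiHolonomic (kBinomGerm F) := by
  obtain ⟨L, hL, hL1⟩ := exists_injective_of_ker_toSpanSingleton (R := A2 F) (kBinomGerm F)
  -- The filtration is generated by the class of 1, which `L` sends to `f`. The dimension formula
  -- holds for every `j`, so the threshold is 0.
  refine ⟨_, isGoodFiltration_cyclicFiltration (exists_smul_mkQ_one_eq _), _,
    natDegree_simplexPolynomial, 0, fun j _ => ?_⟩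
  have h := (finrank_cyclicFiltration_of_injective L hL _ j).trans
    (congrArg (fun v => Module.finrank (Kc F) (cyclicFiltration F v j)) hL1)
  refine (congrArg (Nat.cast (R := ℚ))
    (h.trans (finrank_cyclicFiltration_kBinomGerm j))).trans ?_
  rw [card_pairsLE]
  simp only [Polynomial.eval_mul, Polynomial.eval_add, Polynomial.eval_C, Polynomial.eval_X]
  ring

end GeneratingFunctionModule

end

end QuasiHolonomic

theorem proposition7 (F : Type*) [Field F] [Finite F] :
    -- the double series converges near the origin, with the function `kBinomGenFun` as its sum
    (∀ s t : QuasiHolonomic.Kc F, ‖s‖ < 1 → ‖t‖ < 1 →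
      HasSum (fun p : ℕ × ℕ => QuasiHolonomic.kBinom F p.2 p.1 *
          s ^ QuasiHolonomic.q F ^ p.1 * t ^ QuasiHolonomic.q F ^ p.2)
        (QuasiHolonomic.kBinomGenFun F (s, t))) ∧
    -- its germ at the origin is an element `f` of `𝓕₂`
    ∃ f : QuasiHolonomic.F2 F,
      (f : QuasiHolonomic.Germ2 F) =
          ((QuasiHolonomic.kBinomGenFun F : QuasiHolonomic.Kc F × QuasiHolonomic.Kc F →
            QuasiHolonomic.Kc F) : QuasiHolonomic.Germ2 F) ∧
      -- `d_s f = Δ_t f + [1]^{1/q} f`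
      QuasiHolonomic.dS F f = QuasiHolonomic.deltaT F f +
          QuasiHolonomic.qRoot F (QuasiHolonomic.bracket F 1) • f ∧
      QuasiHolonomic.IsQuasiHolonomic f :=
  ⟨fun _ _ hs ht => QuasiHolonomic.hasSum_kBinomGenFun hs ht, QuasiHolonomic.kBinomGerm F, rfl,
    QuasiHolonomic.dS_kBinomGerm F, QuasiHolonomic.isQuasiHolonomic_kBinomGerm F⟩
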